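/- Let $n,N\in\mathbb N$ with $N>1$, and let $1<p<n$; put $p^*=\frac{np}{n-p}$. Let $\varkappa,\Lambda>0$, $A\in(0,1)$, and let $r,\lambda,s,\mu$ be real numbers with $$r>\tfrac{p}{p-1},\quad \lambda\in[0,n),\quad (p-1)r+\lambda>n,\qquad s>\tfrac{np}{np+p-n},\quad \mu\in[0,n),\quad ps+\mu>n.$$ For a bounded domain $\Omega\subset\mathbb R^n$, $t\ge1$ and $\nu\in[0,n]$, a function $f\in L^t(\Omega)$ belongs to the Morrey space $L^{t,\nu}(\Omega)$ if $$\|f\|_{L^{t,\nu}(\Omega)}=\sup_{x_0\in\Omega,\ 0<\rho<\operatorname{diam}\Omega}\Big(\rho^{-\nu}\int_{B_\rho(x_0)\cap\Omega}|f|^t\,dx\Big)^{1/t}<\infty .$$ Vectors and matrices carry the Euclidean norm. $W^{1,p}_0(\Omega)$ is the closure of $C_0^\infty(\Omega)$ in $W^{1,p}(\Omega)$, and $W^{1,p}_0(\Omega;\mathbb R^N)$ is defined componentwise. Then for all $V,K_\varphi,K_\psi,M\ge0$ there is a constant $C$, depending only on $n,N,p,\varkappa,\Lambda,A,r,\lambda,s,\mu,V,K_\varphi,K_\psi,M$,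 with the following property. Let $\Omega\subset\mathbb R^n$ be a bounded domain with $|\Omega|\le V$ satisfying the measure density condition: for all $\rho\in(0,\operatorname{diam}\Omega)$, $$A\,|B_\rho(x)|\le|B_\rho(x)\cap\Omega|\quad\forall x\in\overline\Omega,\qquad |B_\rho(x)\cap\Omega|\le(1-A)\,|B_\rho(x)|\quad\forall x\in\partial\Omega .$$ Let $\varphi\in L^{r,\lambda}(\Omega)$ and $\psi\in L^{s,\mu}(\Omega)$ be nonnegative with $\|\varphi\|_{L^{r,\lambda}(\Omega)}\le K_\varphi$ and $\|\psi\|_{L^{s,\mu}(\Omega)}\le K_\psi$. Let $\mathbf A=(a_i^\alpha)\colon\Omega\times\mathbb R^N\times\mathbb R^{N\times n}\to\mathbb R^{N\times n}$ and $\mathbf b=(b^\alpha)\colon\Omega\times\mathbb R^N\times\mathbb R^{N\times n}\to\mathbb R^N$ be Carathéodory maps such that for almost all $x\in\Omega$, all $z\in\mathbb R^N$, all $\Xi=(\xi_i^\alpha)\in\mathbb R^{N\times n}$ and all $\alpha,i$, $$|a_i^\alpha(x,z,\Xi)|\le\Lambda\big(\varphi(x)+|z|^{p^*(p-1)/p}+|\Xi|^{p-1}\big),\qquad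 |b^\alpha(x,z,\Xi)|\le\Lambda\big(\psi(x)+|z|^{p^*-1}+|\Xi|^{p(p^*-1)/p^*}\big),$$ $$\sum_{\alpha=1}^N\sum_{i=1}^n a_i^\alpha(x,z,\Xi)\,\xi_i^\alpha\ge\varkappa|\Xi|^p-\Lambda|z|^{p^*}-\Lambda\varphi(x)^{p/(p-1)} .$$ Let $\mathbf u\in L^\infty(\Omega;\mathbb R^N)\cap W^{1,p}_0(\Omega;\mathbb R^N)$ with $\|\mathbf u\|_{L^\infty(\Omega)}\le M$ satisfy $$\int_\Omega\sum_{\alpha,i}a_i^\alpha(x,\mathbf u,D\mathbf u)\,D_iv^\alpha\,dx+\int_\Omega\sum_\alpha b^\alpha(x,\mathbf u,D\mathbf u)\,v^\alpha\,dx=0\qquad\forall\,\mathbf v\in W^{1,p}_0(\Omega;\mathbb R^N).$$ Then $$\int_{B_\rho(x_0)\cap\Omega}|D\mathbf u|^p\,dx\le C\rho^{n-p}\qquad\forall x_0\in\overline\Omega,\ \forall\rho\in(0,\operatorname{diam}\Omega),$$ and in particular $D\mathbf u\in L^{p,n-p}(\Omega;\mathbb R^{N\times n})$. -/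

import Mathlib

open MeasureTheory Filter Topology
open scoped ENNReal NNReal

/-- Points of `ℝ^n`, with the Euclidean norm. -/
abbrev Vec (n : ℕ) : Type := EuclideanSpace ℝ (Fin n)

/-- `N × n` matrices `Ξ = (ξ^α_i)`, with the Euclidean (Frobenius) norm; `ξ^α_i` is `Ξ (α, i)`. -/
abbrev Mat (N n : ℕ) : Type := EuclideanSpace ℝ (Fin N × Fin n)

/-- The row `Ξ^α` of the matrix `Ξ`. -/
def Mat.row {N n : ℕ} (Ξ : Mat N n) (α : Fin N) : Vec n :=
  WithLp.toLp 2 fun i => Ξ (α, i)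

/-- A bounded domain: a bounded, open, connected, nonempty set. -/
def IsBoundedDomain {n : ℕ} (Ω : Set (Vec n)) : Prop :=
  IsOpen Ω ∧ IsConnected Ω ∧ Bornology.IsBounded Ω

/-- The two-sided measure density condition with constant `A`: at every point of the closure, `Ω`
fills at least the fraction `A` of each ball of radius `ρ < diam Ω`; at every boundary point the
complement of `Ω` does so too. -/
def MeasureDensity {n : ℕ} (Ω : Set (Vec n)) (A : ℝ) : Prop :=
  (∀ x ∈ closure Ω, ∀ ρ ∈ Set.Ioo 0 (Metric.diam Ω),
    ENNReal.ofReal A * volume (Metric.ball x ρ) ≤ volume (Metric.ball x ρ ∩ Ω)) ∧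
  (∀ x ∈ frontier Ω, ∀ ρ ∈ Set.Ioo 0 (Metric.diam Ω),
    volume (Metric.ball x ρ ∩ Ω) ≤ ENNReal.ofReal (1 - A) * volume (Metric.ball x ρ))

/-- `C_0^∞(Ω)`: smooth functions with compact support contained in `Ω`. -/
def IsTestFunction {n : ℕ} (Ω : Set (Vec n)) (η : Vec n → ℝ) : Prop :=
  ContDiff ℝ (⊤ : ℕ∞) η ∧ HasCompactSupport η ∧ tsupport η ⊆ Ω

/-- `u ∈ W^{1,p}(Ω)` with weak gradient `g`: both lie in `L^p(Ω)`, and integration by parts holds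
against all test functions. -/
def MemSobolev {n : ℕ} (Ω : Set (Vec n)) (p : ℝ) (u : Vec n → ℝ) (g : Vec n → Vec n) : Prop :=
  MemLp u (ENNReal.ofReal p) (volume.restrict Ω) ∧
  MemLp g (ENNReal.ofReal p) (volume.restrict Ω) ∧
  ∀ η : Vec n → ℝ, IsTestFunction Ω η → ∀ i : Fin n,
    ∫ x in Ω, u x * gradient η x i = -∫ x in Ω, g x i * η x

/-- `u ∈ W^{1,p}_0(Ω)` with weak gradient `g`: `u` is a limit in the `W^{1,p}(Ω)` norm of a sequence
of functions of class `C_0^∞(Ω)`. -/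
def MemSobolevZero {n : ℕ} (Ω : Set (Vec n)) (p : ℝ) (u : Vec n → ℝ) (g : Vec n → Vec n) : Prop :=
  MemSobolev Ω p u g ∧
  ∃ η : ℕ → Vec n → ℝ, (∀ k, IsTestFunction Ω (η k)) ∧
    Tendsto (fun k => eLpNorm (fun x => η k x - u x) (ENNReal.ofReal p) (volume.restrict Ω) +
      eLpNorm (fun x => gradient (η k) x - g x) (ENNReal.ofReal p) (volume.restrict Ω))
      atTop (𝓝 0)

/-- `u ∈ W^{1,p}_0(Ω; ℝ^N)` with weak gradient `Du`, componentwise. -/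
def MemSobolevZeroVec {n N : ℕ} (Ω : Set (Vec n)) (p : ℝ) (u : Vec n → Vec N)
    (Du : Vec n → Mat N n) : Prop :=
  ∀ α : Fin N, MemSobolevZero Ω p (fun x => u x α) (fun x => (Du x).row α)

/-- The norm of the Morrey space `L^{r,l}(Ω)`, with values in `[0, ∞]`. -/
noncomputable def morreyNorm {n : ℕ} {F : Type*} [NormedAddCommGroup F] (Ω : Set (Vec n))
    (r l : ℝ) (f : Vec n → F) : ℝ≥0∞ :=
  ⨆ x₀ ∈ Ω, ⨆ ρ ∈ Set.Ioo 0 (Metric.diam Ω),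
    (ENNReal.ofReal (1 / ρ ^ l) * ∫⁻ x in Metric.ball x₀ ρ ∩ Ω, ‖f x‖ₑ ^ r) ^ (1 / r)

/-- Membership in the Morrey space `L^{r,l}(Ω)`. -/
def MemMorrey {n : ℕ} {F : Type*} [NormedAddCommGroup F] (Ω : Set (Vec n))
    (r l : ℝ) (f : Vec n → F) : Prop :=
  MemLp f (ENNReal.ofReal r) (volume.restrict Ω) ∧ morreyNorm Ω r l f < ∞

/-- The Sobolev conjugate `p^* = n p / (n - p)` for `1 < p < n`. -/
noncomputable def sobolevConj (n : ℕ) (p : ℝ) : ℝ := n * p / (n - p)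

/-- Carathéodory maps on `Ω`: measurable in `x` for fixed `(z, Ξ)`, and continuous in `(z, Ξ)` for
almost every `x`. -/
def IsCaratheodory {n N : ℕ} {F : Type*} [NormedAddCommGroup F] (Ω : Set (Vec n))
    (f : Vec n → Vec N → Mat N n → F) : Prop :=
  (∀ z Ξ, AEStronglyMeasurable (fun x => f x z Ξ) (volume.restrict Ω)) ∧
  ∀ᵐ x ∂volume.restrict Ω, Continuous fun q : Vec N × Mat N n => f x q.1 q.2

/-- The controlled growth conditions. -/
def ControlledGrowth {n N : ℕ} (Ω : Set (Vec n)) (p Λ : ℝ) (φ ψ : Vec n → ℝ)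
    (a : Vec n → Vec N → Mat N n → Mat N n) (b : Vec n → Vec N → Mat N n → Vec N) : Prop :=
  ∀ᵐ x ∂volume.restrict Ω, ∀ (z : Vec N) (Ξ : Mat N n),
    (∀ (α : Fin N) (i : Fin n), |a x z Ξ (α, i)| ≤
      Λ * (φ x + ‖z‖ ^ (sobolevConj n p * (p - 1) / p) + ‖Ξ‖ ^ (p - 1))) ∧
    ∀ α : Fin N, |b x z Ξ α| ≤
      Λ * (ψ x + ‖z‖ ^ (sobolevConj n p - 1) +
        ‖Ξ‖ ^ (p * (sobolevConj n p - 1) / sobolevConj n p))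

/-- The general coercivity condition. -/
def Coercive {n N : ℕ} (Ω : Set (Vec n)) (p κ Λ : ℝ) (φ : Vec n → ℝ)
    (a : Vec n → Vec N → Mat N n → Mat N n) : Prop :=
  ∀ᵐ x ∂volume.restrict Ω, ∀ (z : Vec N) (Ξ : Mat N n),
    κ * ‖Ξ‖ ^ p - Λ * ‖z‖ ^ sobolevConj n p - Λ * φ x ^ (p / (p - 1)) ≤
      ∑ α : Fin N, ∑ i : Fin n, a x z Ξ (α, i) * Ξ (α, i)

/-- `u ∈ W^{1,p}_0(Ω; ℝ^N)`, with weak gradient `Du`, is a weak solution of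
`div (a(x, u, Du)) = b(x, u, Du)` in `Ω`. Both integrals converge absolutely under the controlled
growth conditions with `φ ∈ L^{p/(p-1)}(Ω)` and `ψ ∈ L^{np/(np+p-n)}(Ω)`. -/
def IsWeakSolution {n N : ℕ} (Ω : Set (Vec n)) (p : ℝ)
    (a : Vec n → Vec N → Mat N n → Mat N n) (b : Vec n → Vec N → Mat N n → Vec N)
    (u : Vec n → Vec N) (Du : Vec n → Mat N n) : Prop :=
  MemSobolevZeroVec Ω p u Du ∧
  ∀ (v : Vec n → Vec N) (Dv : Vec n → Mat N n), MemSobolevZeroVec Ω p v Dv →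
    (∫ x in Ω, ∑ α : Fin N, ∑ i : Fin n, a x (u x) (Du x) (α, i) * Dv x (α, i)) +
      (∫ x in Ω, ∑ α : Fin N, b x (u x) (Du x) α * v x α) = 0

/-!
The estimate is a Caccioppoli inequality. Let `η` be a cutoff function between the balls of radii
`ρ` and `2 * ρ` around `x₀`, and let `k = ⌈p⌉₊`. As `u` vanishes on the boundary, `η ^ k • u` lies in
`W^{1,p}_0` (`MemSobolevZeroVec.smooth_smul`) for interior and boundary balls alike, and it is
bounded, so the weak formulation can be tested with it. Coercivity bounds the integral of
`η ^ k * ‖Du‖ ^ p` by three kinds of terms (`exists_pointwise_estimate`).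

* Terms with the gradient of `η`: Young's inequality absorbs the part of order `‖Du‖ ^ (p - 1)` and
  leaves `ρ ^ (-p)`, whose integral over a ball of radius `2 * ρ` has order `ρ ^ (n - p)`.
* Terms with `b`: the growth exponent `p * (p^* - 1) / p^*` of `b` in the gradient is strictly less
  than `p`. For bounded `u` this part is therefore absorbed with no smallness assumption.
* Terms with `φ ^ (p / (p - 1))` and `ψ`: the Hölder inequality in the Morrey spaces
  (`exists_integral_rpow_ball_closure_le`) gives powers of the radius that are at least `n - p`
  precisely because `n ≤ (p - 1) * r + l` and `n ≤ p * s + m`.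

Powers of the radius with larger exponents are compared with `ρ ^ (n - p)` by means of a bound for the
diameter of `Ω`. The measure density condition and the bound for the volume provide it
(`exists_bound_radius`); the proof uses that condition for nothing else.
-/

/-! ### Products with smooth cutoff functions -/

theorem norm_gradient_eq_norm_fderiv {n : ℕ} (f : Vec n → ℝ) (x : Vec n) :
    ‖gradient f x‖ = ‖fderiv ℝ f x‖ := by
  unfold gradient
  exact LinearIsometryEquiv.norm_map _ _

theorem gradient_fun_mul {n : ℕ} {f g : Vec n → ℝ} {x : Vec n} (hf : DifferentiableAt ℝ f x)
    (hg : DifferentiableAt ℝ g x) :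
    gradient (fun y => f y * g y) x = f x • gradient g x + g x • gradient f x := by
  unfold gradient
  rw [fderiv_fun_mul hf hg]
  simp

theorem continuous_gradient {n : ℕ} {f : Vec n → ℝ} (hf : ContDiff ℝ (⊤ : ℕ∞) f) :
    Continuous (gradient f) := by
  unfold gradient
  exact (LinearIsometryEquiv.continuous _).comp (hf.continuous_fderiv (by simp))

theorem exists_bound_of_hasCompactSupport {n : ℕ} {f : Vec n → ℝ}
    (hf : ContDiff ℝ (⊤ : ℕ∞) f) (hc : HasCompactSupport f) :
    ∃ B : ℝ, 0 ≤ B ∧ (∀ x, |f x| ≤ B) ∧ ∀ x, ‖gradient f x‖ ≤ B := by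
  obtain ⟨B₀, hB₀⟩ := hc.exists_bound_of_continuous hf.continuous
  obtain ⟨B₁, hB₁⟩ := (hc.fderiv (𝕜 := ℝ)).exists_bound_of_continuous
    (hf.continuous_fderiv (by simp))
  refine ⟨max B₀ B₁, ((norm_nonneg _).trans (hB₀ 0)).trans (le_max_left _ _), fun x => ?_,
    fun x => ?_⟩
  · exact (hB₀ x).trans (le_max_left _ _)
  · rw [norm_gradient_eq_norm_fderiv]
    exact (hB₁ x).trans (le_max_right _ _)

/-- Smooth cutoff functions between concentric balls of radii `ρ` and `2 * ρ`, with a gradient of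
order `1 / ρ`: rescaled translates of a single bump function. -/
theorem exists_cutoff (n : ℕ) : ∃ c : ℝ, 0 ≤ c ∧ ∀ (x₀ : Vec n) (ρ : ℝ), 0 < ρ →
    ∃ η : Vec n → ℝ, ContDiff ℝ (⊤ : ℕ∞) η ∧ HasCompactSupport η ∧ (∀ x, 0 ≤ η x) ∧
      (∀ x, η x ≤ 1) ∧ (∀ x ∈ Metric.ball x₀ ρ, η x = 1) ∧
      (∀ x ∉ Metric.ball x₀ (2 * ρ), η x = 0) ∧ ∀ x, ‖gradient η x‖ ≤ c / ρ := by
  let Φ : ContDiffBump (0 : Vec n) := ⟨1, 2, one_pos, one_lt_two⟩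
  obtain ⟨c, hc0, -, hc⟩ := exists_bound_of_hasCompactSupport (f := Φ) Φ.contDiff
    Φ.hasCompactSupport
  refine ⟨c, hc0, fun x₀ ρ hρ => ?_⟩
  have hzero : ∀ x ∉ Metric.ball x₀ (2 * ρ), Φ (ρ⁻¹ • (x - x₀)) = 0 := by
    intro x hx
    apply Φ.zero_of_le_dist
    rw [Metric.mem_ball, not_lt, dist_eq_norm] at hx
    rw [dist_zero_right, norm_smul, norm_inv, Real.norm_of_nonneg hρ.le, inv_mul_eq_div,
      le_div_iff₀ hρ]
    exact hx
  refine ⟨fun x => Φ (ρ⁻¹ • (x - x₀)), ?_, ?_, fun x => Φ.nonneg, fun x => Φ.le_one, ?_,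
    hzero, ?_⟩
  · exact Φ.contDiff.comp ((contDiff_id.sub contDiff_const).const_smul _)
  · refine HasCompactSupport.of_support_subset_isCompact (isCompact_closedBall x₀ (2 * ρ)) ?_
    intro x hx
    by_contra h
    exact hx (hzero x fun h' => h (Metric.ball_subset_closedBall h'))
  · intro x hx
    apply Φ.one_of_mem_closedBall
    rw [Metric.mem_ball, dist_eq_norm] at hx
    rw [Metric.mem_closedBall, dist_zero_right, norm_smul, norm_inv, Real.norm_of_nonneg hρ.le,
      inv_mul_eq_div, div_le_iff₀ hρ, show Φ.rIn = 1 from rfl]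
    linarith
  · intro x
    rw [norm_gradient_eq_norm_fderiv]
    have h1 : HasFDerivAt (fun x : Vec n => ρ⁻¹ • (x - x₀))
        (ρ⁻¹ • ContinuousLinearMap.id ℝ (Vec n)) x :=
      ((hasFDerivAt_id x).sub_const x₀).const_smul ρ⁻¹
    have hd : DifferentiableAt ℝ Φ (ρ⁻¹ • (x - x₀)) :=
      (Φ.contDiff (n := 1)).differentiable (by simp) _
    have h2 : HasFDerivAt (fun x => Φ (ρ⁻¹ • (x - x₀)))
        ((fderiv ℝ Φ (ρ⁻¹ • (x - x₀))).comp (ρ⁻¹ • ContinuousLinearMap.id ℝ (Vec n))) x :=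
      HasFDerivAt.comp (g := Φ) (f := fun x : Vec n => ρ⁻¹ • (x - x₀)) x hd.hasFDerivAt h1
    rw [h2.fderiv, ContinuousLinearMap.comp_smul, ContinuousLinearMap.comp_id, norm_smul, norm_inv,
      Real.norm_of_nonneg hρ.le, inv_mul_eq_div]
    have := hc (ρ⁻¹ • (x - x₀))
    rw [norm_gradient_eq_norm_fderiv] at this
    gcongr

theorem gradient_fun_pow {n : ℕ} {f : Vec n → ℝ} {x : Vec n} (hf : DifferentiableAt ℝ f x)
    (k : ℕ) : gradient (fun y => f y ^ k) x = (k * f x ^ (k - 1)) • gradient f x := by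
  unfold gradient
  rw [fderiv_fun_pow k hf]
  simp

section Product

variable {n N : ℕ} {Ω : Set (Vec n)} {p : ℝ} {ζ : Vec n → ℝ}

theorem IsTestFunction.mul {η : Vec n → ℝ} (hη : IsTestFunction Ω η)
    (hζ : ContDiff ℝ (⊤ : ℕ∞) ζ) : IsTestFunction Ω fun x => ζ x * η x :=
  ⟨hζ.mul hη.1, hη.2.1.mul_left, (tsupport_mul_subset_right (f := ζ) (g := η)).trans hη.2.2⟩

/-- The space `W^{1,p}(Ω)` is stable under multiplication by `C_0^∞(ℝ^n)`, with the Leibniz rule. -/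
theorem MemSobolev.smooth_mul {u : Vec n → ℝ} {g : Vec n → Vec n} (h : MemSobolev Ω p u g)
    (hp : 1 ≤ p) (hΩ : volume Ω < ∞) (hζ : ContDiff ℝ (⊤ : ℕ∞) ζ) (hc : HasCompactSupport ζ) :
    MemSobolev Ω p (fun x => ζ x * u x) (fun x => ζ x • g x + u x • gradient ζ x) := by
  obtain ⟨hu, hg, hint⟩ := h
  obtain ⟨B, hB0, hB, hB'⟩ := exists_bound_of_hasCompactSupport hζ hc
  have : IsFiniteMeasure (volume.restrict Ω) := ⟨by simpa using hΩ⟩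
  have hgrad := continuous_gradient hζ
  have hp' : 1 ≤ ENNReal.ofReal p := by simpa using ENNReal.ofReal_le_ofReal hp
  refine ⟨?_, ?_, ?_⟩
  · refine hu.of_le_mul (c := B) (hζ.continuous.aestronglyMeasurable.mul hu.1)
      (ae_of_all _ fun x => ?_)
    rw [norm_mul]
    gcongr
    exact hB x
  · refine MemLp.add ?_ ?_
    · refine hg.of_le_mul (c := B) (hζ.continuous.aestronglyMeasurable.smul hg.1)
        (ae_of_all _ fun x => ?_)
      rw [norm_smul]
      gcongr
      exact hB x
    · refine hu.of_le_mul (c := B) (hu.1.smul hgrad.aestronglyMeasurable)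
        (ae_of_all _ fun x => ?_)
      rw [norm_smul, mul_comm]
      gcongr
      exact hB' x
  · intro η hη i
    obtain ⟨E, hE0, hE, hE'⟩ := exists_bound_of_hasCompactSupport hη.1 hη.2.1
    have key := hint _ (hη.mul hζ) i
    have hui : Integrable u (volume.restrict Ω) := hu.integrable hp'
    have hgi : Integrable g (volume.restrict Ω) := hg.integrable hp'
    have hci : ∀ {f : Vec n → Vec n}, Continuous f → Continuous fun x => f x i := by
      intro f hf
      fun_prop
    have hgradη := continuous_gradient hη.1
    have hle : ∀ (v : Vec n), |v i| ≤ ‖v‖ := fun v => by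
      simpa using PiLp.norm_apply_le v i
    have hI1 : Integrable (fun x => ζ x * u x * gradient η x i) (volume.restrict Ω) := by
      refine (hui.norm.const_mul (B * E)).mono'
        ((hζ.continuous.aestronglyMeasurable.mul hu.1).mul (hci hgradη).aestronglyMeasurable)
        (ae_of_all _ fun x => ?_)
      rw [norm_mul, norm_mul]
      calc ‖ζ x‖ * ‖u x‖ * ‖gradient η x i‖ ≤ B * ‖u x‖ * E := by
            gcongr
            · exact hB x
            · exact (hle _).trans (hE' x)
        _ = B * E * ‖u x‖ := by ring
    have hI2 : Integrable (fun x => u x * gradient ζ x i * η x) (volume.restrict Ω) := by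
      refine (hui.norm.const_mul (B * E)).mono'
        ((hu.1.mul (hci hgrad).aestronglyMeasurable).mul
          hη.1.continuous.aestronglyMeasurable) (ae_of_all _ fun x => ?_)
      rw [norm_mul, norm_mul]
      calc ‖u x‖ * ‖gradient ζ x i‖ * ‖η x‖ ≤ ‖u x‖ * B * E := by
            gcongr
            · exact (hle _).trans (hB' x)
            · exact hE x
        _ = B * E * ‖u x‖ := by ring
    have hI3 : Integrable (fun x => g x i * (ζ x * η x)) (volume.restrict Ω) := by
      refine (hgi.norm.const_mul (B * E)).mono' ?_ (ae_of_all _ fun x => ?_)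
      · exact (hgi.eval_piLp i).1.mul (hζ.continuous.mul hη.1.continuous).aestronglyMeasurable
      rw [norm_mul, norm_mul]
      calc ‖g x i‖ * (‖ζ x‖ * ‖η x‖) ≤ ‖g x‖ * (B * E) := by
            gcongr
            · exact hle _
            · exact hB x
            · exact hE x
        _ = B * E * ‖g x‖ := by ring
    have e1 : ∀ x, u x * gradient (fun x => ζ x * η x) x i
        = ζ x * u x * gradient η x i + u x * gradient ζ x i * η x := by
      intro x
      rw [gradient_fun_mul (hζ.differentiable (by simp) x) (hη.1.differentiable (by simp) x)]
      simp only [PiLp.add_apply, PiLp.smul_apply, smul_eq_mul]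
      ring
    simp_rw [e1] at key
    rw [integral_add hI1 hI2] at key
    have e2 : ∀ x, (ζ x • g x + u x • gradient ζ x) i * η x
        = g x i * (ζ x * η x) + u x * gradient ζ x i * η x := by
      intro x
      simp only [PiLp.add_apply, PiLp.smul_apply, smul_eq_mul]
      ring
    simp_rw [e2]
    rw [integral_add hI3 hI2]
    linarith

/-- Multiplication by a function of class `C_0^∞(ℝ^n)` preserves `W^{1,p}_0(Ω)`: it maps test
functions in `Ω` to test functions in `Ω`, and it is bounded in the `W^{1,p}` norm. -/
theorem MemSobolevZero.smooth_mul {u : Vec n → ℝ} {g : Vec n → Vec n}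
    (h : MemSobolevZero Ω p u g) (hp : 1 ≤ p) (hΩ : volume Ω < ∞)
    (hζ : ContDiff ℝ (⊤ : ℕ∞) ζ) (hc : HasCompactSupport ζ) :
    MemSobolevZero Ω p (fun x => ζ x * u x) (fun x => ζ x • g x + u x • gradient ζ x) := by
  obtain ⟨hS, η, hη, hlim⟩ := h
  refine ⟨hS.smooth_mul hp hΩ hζ hc, fun k x => ζ x * η k x, fun k => (hη k).mul hζ, ?_⟩
  obtain ⟨B, hB0, hB, hB'⟩ := exists_bound_of_hasCompactSupport hζ hc
  have hp' : 1 ≤ ENNReal.ofReal p := by simpa using ENNReal.ofReal_le_ofReal hp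
  have hlim' := ENNReal.Tendsto.const_mul (a := 2 * ENNReal.ofReal B) hlim
    (Or.inr (by finiteness))
  rw [mul_zero] at hlim'
  refine tendsto_of_tendsto_of_tendsto_of_le_of_le tendsto_const_nhds hlim' (fun _ => zero_le)
    fun k => ?_
  have hgrad := continuous_gradient hζ
  have hgradη := continuous_gradient (hη k).1
  have hdu : AEStronglyMeasurable (fun x => η k x - u x) (volume.restrict Ω) :=
    (hη k).1.continuous.aestronglyMeasurable.sub hS.1.1
  have hdg : AEStronglyMeasurable (fun x => gradient (η k) x - g x) (volume.restrict Ω) :=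
    hgradη.aestronglyMeasurable.sub hS.2.1.1
  set e₀ := eLpNorm (fun x => η k x - u x) (ENNReal.ofReal p) (volume.restrict Ω)
  set e₁ := eLpNorm (fun x => gradient (η k) x - g x) (ENNReal.ofReal p) (volume.restrict Ω)
  have h1 : eLpNorm (fun x => ζ x * η k x - ζ x * u x) (ENNReal.ofReal p) (volume.restrict Ω)
      ≤ ENNReal.ofReal B * e₀ := by
    refine eLpNorm_le_mul_eLpNorm_of_ae_le_mul (ae_of_all _ fun x => ?_) _
    rw [← mul_sub, norm_mul]
    gcongr
    exact hB x
  have h2 : eLpNorm (fun x => ζ x • (gradient (η k) x - g x)) (ENNReal.ofReal p)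
      (volume.restrict Ω) ≤ ENNReal.ofReal B * e₁ := by
    refine eLpNorm_le_mul_eLpNorm_of_ae_le_mul (ae_of_all _ fun x => ?_) _
    rw [norm_smul]
    gcongr
    exact hB x
  have h3 : eLpNorm (fun x => (η k x - u x) • gradient ζ x) (ENNReal.ofReal p)
      (volume.restrict Ω) ≤ ENNReal.ofReal B * e₀ := by
    refine eLpNorm_le_mul_eLpNorm_of_ae_le_mul (ae_of_all _ fun x => ?_) _
    rw [norm_smul, mul_comm]
    gcongr
    exact hB' x
  have e : (fun x => gradient (fun x => ζ x * η k x) x - (ζ x • g x + u x • gradient ζ x))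
      = (fun x => ζ x • (gradient (η k) x - g x)) + fun x => (η k x - u x) • gradient ζ x := by
    funext x
    rw [gradient_fun_mul (hζ.differentiable (by simp) x) ((hη k).1.differentiable (by simp) x)]
    simp only [Pi.add_apply, smul_sub, sub_smul]
    abel
  have h4 := eLpNorm_add_le (hζ.continuous.aestronglyMeasurable.smul hdg)
    (hdu.smul hgrad.aestronglyMeasurable) hp'
  calc _ ≤ ENNReal.ofReal B * e₀ + (ENNReal.ofReal B * e₁ + ENNReal.ofReal B * e₀) := by
        rw [e]
        exact add_le_add h1 (h4.trans (add_le_add h2 h3))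
    _ ≤ ENNReal.ofReal B * e₀ + (ENNReal.ofReal B * e₁ + ENNReal.ofReal B * e₀)
        + ENNReal.ofReal B * e₁ := le_self_add
    _ = _ := by ring

theorem MemSobolevZeroVec.smooth_smul {u : Vec n → Vec N} {Du : Vec n → Mat N n}
    (h : MemSobolevZeroVec Ω p u Du) (hp : 1 ≤ p) (hΩ : volume Ω < ∞)
    (hζ : ContDiff ℝ (⊤ : ℕ∞) ζ) (hc : HasCompactSupport ζ) :
    MemSobolevZeroVec Ω p (fun x => ζ x • u x)
      (fun x => WithLp.toLp 2 fun q => ζ x * Du x q + u x q.1 * gradient ζ x q.2) :=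
  fun α => (h α).smooth_mul hp hΩ hζ hc

theorem MemSobolevZeroVec.memLp_fst {u : Vec n → Vec N} {Du : Vec n → Mat N n}
    (h : MemSobolevZeroVec Ω p u Du) : MemLp u (ENNReal.ofReal p) (volume.restrict Ω) :=
  MemLp.of_eval_piLp fun α => (h α).1.1

theorem MemSobolevZeroVec.memLp_snd {u : Vec n → Vec N} {Du : Vec n → Mat N n}
    (h : MemSobolevZeroVec Ω p u Du) : MemLp Du (ENNReal.ofReal p) (volume.restrict Ω) :=
  MemLp.of_eval_piLp fun q => (h q.1).1.2.1.eval_piLp q.2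

end Product

/-- Superposition: a Carathéodory map composed with measurable functions is measurable. The
functions are replaced by simple functions, and the continuity of the map passes to the limit. -/
theorem IsCaratheodory.aestronglyMeasurable_comp {n N : ℕ} {F : Type*} [NormedAddCommGroup F]
    {Ω : Set (Vec n)} {f : Vec n → Vec N → Mat N n → F} (hf : IsCaratheodory Ω f)
    {u : Vec n → Vec N} {Du : Vec n → Mat N n}
    (hu : AEStronglyMeasurable u (volume.restrict Ω))
    (hDu : AEStronglyMeasurable Du (volume.restrict Ω)) :
    AEStronglyMeasurable (fun x => f x (u x) (Du x)) (volume.restrict Ω) := by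
  have hw := hu.prodMk hDu
  set w : Vec n → Vec N × Mat N n := hw.mk _
  have hwm : StronglyMeasurable w := hw.stronglyMeasurable_mk
  have hsimple : ∀ k, AEStronglyMeasurable
      (fun x => f x (hwm.approx k x).1 (hwm.approx k x).2) (volume.restrict Ω) := by
    intro k
    set s := hwm.approx k
    have hcov : ⋃ q ∈ s.range, s ⁻¹' {q} = Set.univ := by
      ext x
      simp
    have : AEStronglyMeasurable (fun x => f x (s x).1 (s x).2)
        ((volume.restrict Ω).restrict (⋃ q : s.range, s ⁻¹' {q.1})) := by
      rw [aestronglyMeasurable_iUnion_iff]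
      intro q
      refine ((hf.1 q.1.1 q.1.2).restrict).congr ?_
      filter_upwards [ae_restrict_mem (s.measurableSet_preimage {q.1})] with x hx
      have hx : s x = q.1 := hx
      rw [hx]
    rwa [Set.iUnion_subtype, hcov, Measure.restrict_univ] at this
  refine aestronglyMeasurable_of_tendsto_ae atTop hsimple ?_
  filter_upwards [hf.2, hw.ae_eq_mk] with x hx hwx
  have h1 := (hx.tendsto (w x)).comp (hwm.tendsto_approx x)
  have h2 : w x = (u x, Du x) := hwx.symm
  rw [h2] at h1
  exact h1

/-! ### Morrey norms and integrals over balls -/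

/-- A Morrey norm bound controls the integrals over all balls centred in `Ω`, without restriction
on the radius: radii `≥ diam Ω` reduce to the radius `diam Ω`, because spheres are null sets, and
that radius is the limit of smaller ones. -/
theorem lintegral_ball_le_of_morreyNorm_le {n : ℕ} (hn : 0 < n) {F : Type*} [NormedAddCommGroup F]
    {Ω : Set (Vec n)} (hb : Bornology.IsBounded Ω) (hd : 0 < Metric.diam Ω)
    {t ν : ℝ} (ht : 0 < t) (hν : 0 ≤ ν) {f : Vec n → F} {K : ℝ≥0}
    (hK : morreyNorm Ω t ν f ≤ K) {x : Vec n} (hx : x ∈ Ω) {R : ℝ} (hR : 0 < R) :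
    ∫⁻ y in Metric.ball x R ∩ Ω, ‖f y‖ₑ ^ t ≤ ENNReal.ofReal ((K : ℝ) ^ t * R ^ ν) := by
  have : Nonempty (Fin n) := ⟨⟨0, hn⟩⟩
  have hsmall : ∀ ρ ∈ Set.Ioo 0 (Metric.diam Ω),
      ∫⁻ y in Metric.ball x ρ ∩ Ω, ‖f y‖ₑ ^ t ≤ ENNReal.ofReal ((K : ℝ) ^ t * ρ ^ ν) := by
    intro ρ hρ
    have h1 : (ENNReal.ofReal (1 / ρ ^ ν) * ∫⁻ y in Metric.ball x ρ ∩ Ω, ‖f y‖ₑ ^ t) ^ (1 / t)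
        ≤ K := by
      refine le_trans ?_ hK
      unfold morreyNorm
      refine le_iSup₂_of_le x hx ?_
      exact le_iSup₂ (f := fun ρ (_ : ρ ∈ Set.Ioo 0 (Metric.diam Ω)) =>
        (ENNReal.ofReal (1 / ρ ^ ν) * ∫⁻ y in Metric.ball x ρ ∩ Ω, ‖f y‖ₑ ^ t) ^ (1 / t)) ρ hρ
    rw [one_div t, ENNReal.rpow_inv_le_iff ht] at h1
    have hpos : 0 < ρ ^ ν := Real.rpow_pos_of_pos hρ.1 _
    rw [one_div, ENNReal.ofReal_inv_of_pos hpos, mul_comm, ← div_eq_mul_inv,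
      ENNReal.div_le_iff (by simpa using hpos) (by finiteness)] at h1
    refine h1.trans (le_of_eq ?_)
    rw [ENNReal.ofReal_mul (by positivity), ← ENNReal.ofReal_rpow_of_nonneg (by positivity) ht.le]
    simp
  rcases lt_or_ge R (Metric.diam Ω) with h | h
  · exact hsmall R ⟨hR, h⟩
  obtain ⟨r, hmono, hr, hlim⟩ := exists_seq_strictMono_tendsto' hd
  have hsub : (Metric.ball x R ∩ Ω : Set (Vec n)) ≤ᵐ[volume]
      (⋃ k, Metric.ball x (r k) ∩ Ω : Set (Vec n)) := by
    have hnull : volume (Metric.sphere x (Metric.diam Ω)) = 0 := Measure.addHaar_sphere _ _ _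
    filter_upwards [measure_eq_zero_iff_ae_notMem.1 hnull] with y hy
    rintro ⟨-, hyΩ⟩
    have hlt : dist y x < Metric.diam Ω :=
      lt_of_le_of_ne (Metric.dist_le_diam_of_mem hb hyΩ hx) hy
    obtain ⟨k, hk⟩ := (hlim.eventually (lt_mem_nhds hlt)).exists
    exact Set.mem_iUnion.2 ⟨k, hk, hyΩ⟩
  have hdir : Directed (· ⊆ ·) fun k => Metric.ball x (r k) ∩ Ω :=
    (directed_of_isDirected_le fun i j hij =>
      Set.inter_subset_inter_left _ (Metric.ball_subset_ball (hmono.monotone hij)))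
  calc ∫⁻ y in Metric.ball x R ∩ Ω, ‖f y‖ₑ ^ t
      ≤ ∫⁻ y in ⋃ k, Metric.ball x (r k) ∩ Ω, ‖f y‖ₑ ^ t := lintegral_mono_set' hsub
    _ = ⨆ k, ∫⁻ y in Metric.ball x (r k) ∩ Ω, ‖f y‖ₑ ^ t :=
        by simpa only [withDensity_apply'] using
          hdir.measure_iUnion (μ := volume.withDensity fun y => ‖f y‖ₑ ^ t)
    _ ≤ _ := by
        refine iSup_le fun k => (hsmall _ (hr k)).trans (ENNReal.ofReal_le_ofReal ?_)
        have := (hr k).1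
        gcongr
        exact (hr k).2.le.trans h

/-- The Hölder inequality lowers the exponent in a Morrey bound: for `e ≤ t` the integral of
`‖f‖ ^ e` over a ball of radius `R` is of order `R ^ (n - (n - ν) * e / t)`, hence of order
`R ^ d` for bounded radii whenever `d ≤ n - (n - ν) * e / t`. -/
theorem exists_integral_rpow_ball_le {n : ℕ} (hn : 0 < n) {t ν e d : ℝ} (he : 0 < e) (het : e ≤ t)
    (hν : 0 ≤ ν) (hd : d ≤ n - (n - ν) * (e / t)) (K : ℝ≥0) (D : ℝ) :
    ∃ C : ℝ, 0 ≤ C ∧ ∀ (Ω : Set (Vec n)) (f : Vec n → ℝ), Bornology.IsBounded Ω →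
      0 < Metric.diam Ω → AEStronglyMeasurable f (volume.restrict Ω) → morreyNorm Ω t ν f ≤ K →
      ∀ x ∈ Ω, ∀ R, 0 < R → R ≤ D → ∫ y in Metric.ball x R ∩ Ω, ‖f y‖ ^ e ≤ C * R ^ d := by
  have : Nonempty (Fin n) := ⟨⟨0, hn⟩⟩
  set ω : ℝ := volume.real (Metric.ball (0 : Vec n) 1) with hω
  have hω0 : 0 ≤ ω := measureReal_nonneg
  have ht : 0 < t := he.trans_le het
  set γ : ℝ := n - (n - ν) * (e / t) with hγ
  refine ⟨(K : ℝ) ^ e * ω ^ (1 - e / t) * D ^ (γ - d) ⊔ 0, le_max_right _ _, ?_⟩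
  intro Ω f hb hdiam hf hK x hx R hR hRD
  have hD : 0 < D := hR.trans_le hRD
  have h1 := lintegral_ball_le_of_morreyNorm_le hn hb hdiam ht hν hK hx hR
  have hvol : volume (Metric.ball x R ∩ Ω) ≤ ENNReal.ofReal (ω * R ^ (n : ℝ)) := by
    refine (measure_mono Set.inter_subset_left).trans (le_of_eq ?_)
    rw [Measure.addHaar_ball _ _ hR.le, mul_comm, ENNReal.ofReal_mul hω0, hω,
      ofReal_measureReal (by finiteness)]
    simp
  have h2 := eLpNorm'_le_eLpNorm'_mul_rpow_measure_univ he het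
    (hf.mono_measure (Measure.restrict_mono (Set.inter_subset_right (s := Metric.ball x R)) le_rfl))
  have h3 : ∫⁻ y in Metric.ball x R ∩ Ω, ‖f y‖ₑ ^ e ≤
      ENNReal.ofReal ((((K : ℝ) ^ t * R ^ ν) ^ (1 / t) *
        (ω * R ^ (n : ℝ)) ^ (1 / e - 1 / t)) ^ e) := by
    have hexp : 0 ≤ 1 / e - 1 / t := sub_nonneg.2 (one_div_le_one_div_of_le he het)
    rw [← ENNReal.ofReal_rpow_of_nonneg (by positivity) he.le, ← ENNReal.rpow_inv_le_iff he, ← one_div,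
      ENNReal.ofReal_mul (by positivity), ← ENNReal.ofReal_rpow_of_nonneg (by positivity)
        (by positivity), ← ENNReal.ofReal_rpow_of_nonneg (by positivity) hexp]
    refine h2.trans ?_
    rw [eLpNorm', Measure.restrict_apply_univ]
    gcongr
  have h4 : (((K : ℝ) ^ t * R ^ ν) ^ (1 / t) * (ω * R ^ (n : ℝ)) ^ (1 / e - 1 / t)) ^ e
      = (K : ℝ) ^ e * ω ^ (1 - e / t) * R ^ γ := by
    rw [Real.mul_rpow (by positivity) (by positivity), ← Real.rpow_mul (by positivity),
      ← Real.rpow_mul (by positivity), Real.mul_rpow (by positivity) (by positivity),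
      Real.mul_rpow hω0 (by positivity), ← Real.rpow_mul (by positivity),
      ← Real.rpow_mul (by positivity), ← Real.rpow_mul (by positivity)]
    have e1 : t * (1 / t * e) = e := by field_simp
    have e2 : (1 / e - 1 / t) * e = 1 - e / t := by field_simp
    have e3 : γ = ν * (1 / t * e) + n * (1 - e / t) := by rw [hγ]; field_simp; ring
    rw [e1, e2, e3, Real.rpow_add hR]
    ring
  have h5 : ∫ y in Metric.ball x R ∩ Ω, ‖f y‖ ^ e ≤ (K : ℝ) ^ e * ω ^ (1 - e / t) * R ^ γ := by
    rw [← ENNReal.ofReal_le_ofReal_iff (by positivity), ← h4]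
    refine le_trans ?_ h3
    refine (Real.ofReal_le_enorm _).trans ((enorm_integral_le_lintegral_enorm _).trans (le_of_eq ?_))
    refine lintegral_congr fun y => ?_
    rw [Real.enorm_rpow_of_nonneg (norm_nonneg _) he.le, enorm_norm]
  refine h5.trans ?_
  calc (K : ℝ) ^ e * ω ^ (1 - e / t) * R ^ γ
      = (K : ℝ) ^ e * ω ^ (1 - e / t) * (R ^ (γ - d) * R ^ d) := by
        rw [← Real.rpow_add hR, sub_add_cancel]
    _ ≤ (K : ℝ) ^ e * ω ^ (1 - e / t) * (D ^ (γ - d) * R ^ d) := by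
        have : 0 ≤ γ - d := sub_nonneg.2 hd
        gcongr
    _ = (K : ℝ) ^ e * ω ^ (1 - e / t) * D ^ (γ - d) * R ^ d := by ring
    _ ≤ _ := by
        gcongr
        exact le_max_left _ _

/-- The same bound for balls of radius `2 * ρ` centred in the closure of `Ω`; such a ball lies in
a ball of radius `3 * ρ` centred in `Ω`. -/
theorem exists_integral_rpow_ball_closure_le {n : ℕ} (hn : 0 < n) {t ν e d : ℝ} (he : 0 < e)
    (het : e ≤ t) (hν : 0 ≤ ν) (hd : d ≤ n - (n - ν) * (e / t)) (K : ℝ≥0) (D : ℝ) :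
    ∃ C : ℝ, 0 ≤ C ∧ ∀ (Ω : Set (Vec n)) (f : Vec n → ℝ), Bornology.IsBounded Ω →
      0 < Metric.diam Ω → AEStronglyMeasurable f (volume.restrict Ω) → morreyNorm Ω t ν f ≤ K →
      IntegrableOn (fun y => ‖f y‖ ^ e) Ω →
      ∀ x ∈ closure Ω, ∀ ρ, 0 < ρ → ρ ≤ D →
        ∫ y in Metric.ball x (2 * ρ) ∩ Ω, ‖f y‖ ^ e ≤ C * ρ ^ d := by
  obtain ⟨C, hC0, hC⟩ := exists_integral_rpow_ball_le hn he het hν hd K (3 * D)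
  refine ⟨C * 3 ^ d, by positivity, fun Ω f hb hdiam hf hK hint x hx ρ hρ hρD => ?_⟩
  obtain ⟨y, hy, hxy⟩ := Metric.mem_closure_iff.1 hx ρ hρ
  have hsub : Metric.ball x (2 * ρ) ∩ Ω ⊆ Metric.ball y (3 * ρ) ∩ Ω :=
    Set.inter_subset_inter_left _ (Metric.ball_subset_ball' (by linarith))
  calc ∫ z in Metric.ball x (2 * ρ) ∩ Ω, ‖f z‖ ^ e
      ≤ ∫ z in Metric.ball y (3 * ρ) ∩ Ω, ‖f z‖ ^ e :=
        setIntegral_mono_set (hint.mono_set Set.inter_subset_right)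
          (ae_of_all _ fun z => by positivity) hsub.eventuallyLE
    _ ≤ C * (3 * ρ) ^ d := hC Ω f hb hdiam hf hK y hy _ (by positivity) (by linarith)
    _ = C * 3 ^ d * ρ ^ d := by rw [Real.mul_rpow (by norm_num) hρ.le]; ring

/-- By the measure density condition, an upper bound for the volume of `Ω` bounds its diameter. -/
theorem exists_bound_radius {n : ℕ} (hn : 0 < n) {A : ℝ} (hA : 0 < A) (V : ℝ≥0) :
    ∃ D : ℝ, 0 < D ∧ ∀ Ω : Set (Vec n), Ω.Nonempty → volume Ω ≤ V → MeasureDensity Ω A →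
      ∀ ρ ∈ Set.Ioo 0 (Metric.diam Ω), ρ ≤ D := by
  have : Nonempty (Fin n) := ⟨⟨0, hn⟩⟩
  set ω : ℝ := volume.real (Metric.ball (0 : Vec n) 1) with hω
  have hω0 : 0 < ω :=
    ENNReal.toReal_pos (Metric.measure_ball_pos _ _ one_pos).ne' (by finiteness)
  refine ⟨max 1 (V / (A * ω)), by positivity, fun Ω ⟨x, hx⟩ hV hden ρ hρ => ?_⟩
  rcases le_or_gt ρ 1 with h | h
  · exact h.trans (le_max_left _ _)
  refine le_trans ?_ (le_max_right _ _)
  have h1 := (hden.1 x (subset_closure hx) ρ hρ).trans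
    ((measure_mono Set.inter_subset_right).trans hV)
  rw [Measure.addHaar_ball _ _ hρ.1.le, ← ofReal_measureReal (by finiteness), ← hω,
    ← ENNReal.ofReal_mul (by have := hρ.1; positivity), ← ENNReal.ofReal_mul hA.le,
    ← ENNReal.ofReal_coe_nnreal, ENNReal.ofReal_le_ofReal_iff (by positivity)] at h1
  rw [le_div_iff₀ (by positivity)]
  have h2 : ρ ≤ ρ ^ Module.finrank ℝ (Vec n) := le_self_pow₀ h.le (by simp; omega)
  calc ρ * (A * ω) ≤ ρ ^ Module.finrank ℝ (Vec n) * (A * ω) := by gcongr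
    _ = A * (ρ ^ Module.finrank ℝ (Vec n) * ω) := by ring
    _ ≤ V := h1

/-! ### The pointwise estimate -/

/-- Young's inequality with a small parameter. -/
theorem mul_rpow_sub_one_le {p a b ε : ℝ} (hp : 1 < p) (ha : 0 ≤ a) (hb : 0 ≤ b) (hε : 0 < ε) :
    b * a ^ (p - 1) ≤ ε * a ^ p + ε ^ (1 - p) * b ^ p := by
  have split : ∀ {t : ℝ}, 0 ≤ t → t ^ p = t * t ^ (p - 1) := fun {t} ht => by
    rw [← Real.rpow_one_add' ht (by linarith)]
    congr 1
    ring
  rcases le_total b (ε * a) with h | h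
  · calc b * a ^ (p - 1) ≤ ε * a * a ^ (p - 1) := by gcongr
      _ = ε * a ^ p := by rw [split ha]; ring
      _ ≤ _ := le_add_of_nonneg_right (by positivity)
  · have h' : a ≤ ε⁻¹ * b := by rwa [le_inv_mul_iff₀ hε]
    calc b * a ^ (p - 1) ≤ b * (ε⁻¹ * b) ^ (p - 1) := by
          have : 0 ≤ p - 1 := by linarith
          gcongr
      _ = ε ^ (1 - p) * b ^ p := by
          rw [Real.mul_rpow (by positivity) hb, Real.inv_rpow hε.le, ← Real.rpow_neg hε.le,
            neg_sub, split hb]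
          ring
      _ ≤ _ := le_add_of_nonneg_left (by positivity)

theorem mul_le_rpow_add_rpow {p f y : ℝ} (hp : 1 < p) (hf : 0 ≤ f) (hy : 0 ≤ y) :
    y * f ≤ f ^ (p / (p - 1)) + y ^ p := by
  have hp' : p - 1 ≠ 0 := by linarith
  have := mul_rpow_sub_one_le hp (Real.rpow_nonneg hf (1 / (p - 1))) hy one_pos
  rw [← Real.rpow_mul hf, ← Real.rpow_mul hf, Real.one_rpow, one_mul, one_mul,
    one_div_mul_cancel hp', Real.rpow_one, one_div_mul_eq_div] at this
  exact this

/-- A power with a smaller exponent is absorbed, up to a constant. -/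
theorem exists_mul_rpow_le {q p t ε : ℝ} (hq : 0 ≤ q) (hqp : q < p) (ht : 0 ≤ t) (hε : 0 < ε) :
    ∃ C : ℝ, 0 ≤ C ∧ ∀ X : ℝ, 0 ≤ X → t * X ^ q ≤ ε * X ^ p + C := by
  set Y : ℝ := (t / ε) ^ (p - q)⁻¹ with hY
  have hY0 : 0 ≤ Y := by positivity
  refine ⟨t * Y ^ q, by positivity, fun X hX => ?_⟩
  rcases le_or_gt X Y with h | h
  · exact (by gcongr : t * X ^ q ≤ t * Y ^ q).trans (le_add_of_nonneg_left (by positivity))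
  · have hX' : 0 < X := hY0.trans_lt h
    have h1 : t / ε ≤ X ^ (p - q) :=
      (Real.rpow_inv_le_iff_of_pos (by positivity) hX (by linarith)).1 h.le
    have h2 : t ≤ ε * X ^ (p - q) := by rwa [div_le_iff₀' hε] at h1
    calc t * X ^ q ≤ ε * X ^ (p - q) * X ^ q := by gcongr
      _ = ε * X ^ p := by rw [mul_assoc, ← Real.rpow_add hX', sub_add_cancel]
      _ ≤ _ := le_add_of_nonneg_right (by positivity)

theorem one_lt_sobolevConj {n : ℕ} {p : ℝ} (hp : 1 < p) (hpn : p < n) : 1 < sobolevConj n p := by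
  unfold sobolevConj
  rw [one_lt_div (by linarith)]
  nlinarith

/-- The growth exponent of `b` in the gradient is strictly below `p`: this is what makes the term
containing `b` absorbable for bounded `u`. -/
theorem gradient_exponent_lt {n : ℕ} {p : ℝ} (hp : 1 < p) (hpn : p < n) :
    p * (sobolevConj n p - 1) / sobolevConj n p < p := by
  have := one_lt_sobolevConj hp hpn
  rw [div_lt_iff₀ (by linarith)]
  nlinarith

theorem gradient_exponent_nonneg {n : ℕ} {p : ℝ} (hp : 1 < p) (hpn : p < n) :
    0 ≤ p * (sobolevConj n p - 1) / sobolevConj n p := by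
  have := one_lt_sobolevConj hp hpn
  have : 0 ≤ sobolevConj n p - 1 := by linarith
  positivity

/-- Integrand of the weak formulation for the test function `h ^ k • u`, where `h` is a cutoff
function with gradient `G` and `k = ⌈p⌉₊`. Since `k ≥ p`, the power `h ^ (k - 1)` that comes from
the derivative of the cutoff is at most `(h ^ k) ^ ((p - 1) / p)`, and the terms of order
`‖Ξ‖ ^ (p - 1)` are absorbed on the left. -/
theorem exists_pointwise_estimate (n N : ℕ) {p κ Λ M c : ℝ} (hp : 1 < p) (hpn : p < n)
    (hκ : 0 < κ) (hΛ : 0 < Λ) (hM : 0 ≤ M) (hc : 0 ≤ c) :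
    ∃ C : ℝ, 0 ≤ C ∧ ∀ (ρ : ℝ) (z : Vec N) (Ξ a : Mat N n) (b : Vec N) (f g h : ℝ) (G : Vec n),
      0 < ρ → ‖z‖ ≤ M → 0 ≤ f → 0 ≤ g → 0 ≤ h → h ≤ 1 → ‖G‖ ≤ c / ρ →
      (∀ α i, |a (α, i)| ≤
        Λ * (f + ‖z‖ ^ (sobolevConj n p * (p - 1) / p) + ‖Ξ‖ ^ (p - 1))) →
      (∀ α, |b α| ≤ Λ * (g + ‖z‖ ^ (sobolevConj n p - 1) +
        ‖Ξ‖ ^ (p * (sobolevConj n p - 1) / sobolevConj n p))) →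
      κ * ‖Ξ‖ ^ p - Λ * ‖z‖ ^ sobolevConj n p - Λ * f ^ (p / (p - 1)) ≤
        ∑ α, ∑ i, a (α, i) * Ξ (α, i) →
      κ / 2 * (h ^ ⌈p⌉₊ * ‖Ξ‖ ^ p) ≤
        (∑ α, ∑ i, a (α, i) * (h ^ ⌈p⌉₊ * Ξ (α, i) + z α * ((⌈p⌉₊ * h ^ (⌈p⌉₊ - 1)) * G i)))
        + (∑ α, b α * (h ^ ⌈p⌉₊ * z α))
        + C * (1 + ρ ^ (-p) + f ^ (p / (p - 1)) + g) := by
  have hps := one_lt_sobolevConj hp hpn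
  set P := sobolevConj n p with hP
  set q := p * (P - 1) / P with hq
  set k := ⌈p⌉₊ with hk
  have hpk : p ≤ k := Nat.le_ceil p
  have hk1 : 1 ≤ k := Nat.one_le_iff_ne_zero.2 fun h => by rw [h] at hpk; norm_num at hpk; linarith
  have hP1 : 0 ≤ P - 1 := by linarith
  have hp1 : 0 ≤ p - 1 := by linarith
  have hp0 : 0 < p := by linarith
  obtain ⟨C₃, hC₃, hyoung⟩ := exists_mul_rpow_le (gradient_exponent_nonneg hp hpn)
    (gradient_exponent_lt hp hpn) (by positivity : 0 ≤ N * Λ * M) (by positivity : 0 < κ / 4)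
  set M₁ := M ^ (P * (p - 1) / p) with hM₁
  set M₂ := M ^ (P - 1) with hM₂
  set M₃ := M ^ P with hM₃
  set T := N * n * Λ * M * k * c with hT
  have hM₁0 : 0 ≤ M₁ := by positivity
  have hM₂0 : 0 ≤ M₂ := by positivity
  have hM₃0 : 0 ≤ M₃ := by positivity
  have hT0 : 0 ≤ T := by positivity
  set E : ℝ := (2 + (κ / 4) ^ (1 - p)) * T ^ p with hE
  have hE0 : 0 ≤ E := by positivity
  set L : ℝ := N * Λ * M with hL
  have hL0 : 0 ≤ L := by positivity
  set M₄ := M₁ ^ (p / (p - 1)) with hM₄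
  have hM₄0 : 0 ≤ M₄ := by positivity
  refine ⟨Λ + 1 + M₄ + L * M₂ + L + C₃ + Λ * M₃ + E, by positivity, ?_⟩
  intro ρ z Ξ a b f g h G hρ hz hf hg hh hh1 hG ha hb hcoer
  set X := ‖Ξ‖ with hX
  have hX0 : 0 ≤ X := norm_nonneg _
  set ζ := h ^ k with hζ
  have hζ0 : 0 ≤ ζ := by positivity
  have hζ1 : ζ ≤ 1 := pow_le_one₀ hh hh1
  set H := h ^ (k - 1) with hH
  have hH0 : 0 ≤ H := by positivity
  have hH1 : H ≤ 1 := pow_le_one₀ hh hh1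
  set F := f ^ (p / (p - 1)) with hF
  have hF0 : 0 ≤ F := by positivity
  set w := ζ ^ (1 / p) with hw
  have hw0 : 0 ≤ w := by positivity
  have hHw : H ≤ w ^ (p - 1) := by
    have e1 : w ^ (p - 1) = h ^ ((k : ℝ) * (1 / p) * (p - 1)) := by
      rw [hw, hζ, ← Real.rpow_natCast, ← Real.rpow_mul hh, ← Real.rpow_mul hh]
    rw [e1, hH, ← Real.rpow_natCast]
    refine Real.rpow_le_rpow_of_exponent_ge' hh hh1 (by positivity) ?_
    rw [Nat.cast_sub hk1, Nat.cast_one]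
    have : 1 ≤ (k : ℝ) * (1 / p) := by
      rw [mul_one_div, one_le_div hp0]
      exact hpk
    have e2 : (k : ℝ) * (1 / p) * (p - 1) = k - k * (1 / p) := by field_simp
    rw [e2]
    linarith
  have hwX : (w * X) ^ p = ζ * X ^ p := by
    rw [Real.mul_rpow hw0 hX0, hw, ← Real.rpow_mul hζ0, one_div_mul_cancel hp0.ne',
      Real.rpow_one]
  set τ := T / ρ with hτ
  have hτ0 : 0 ≤ τ := by positivity
  have hτp : τ ^ p = T ^ p * ρ ^ (-p) := by
    rw [hτ, Real.div_rpow hT0 hρ.le, Real.rpow_neg hρ.le, div_eq_mul_inv]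
  -- the terms containing the gradient of the cutoff
  have hcross : |∑ α, ∑ i, a (α, i) * (z α * ((k * H) * G i))|
      ≤ τ * H * (f + M₁ + X ^ (p - 1)) := by
    have hterm : ∀ α i, |a (α, i) * (z α * ((k * H) * G i))| ≤
        Λ * (f + M₁ + X ^ (p - 1)) * (M * (k * H * (c / ρ))) := by
      intro α i
      rw [abs_mul, abs_mul, abs_mul, abs_of_nonneg (by positivity : 0 ≤ (k : ℝ) * H)]
      have h1 : |a (α, i)| ≤ Λ * (f + M₁ + X ^ (p - 1)) := by
        refine (ha α i).trans ?_
        have : ‖z‖ ^ (P * (p - 1) / p) ≤ M₁ :=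
          Real.rpow_le_rpow (norm_nonneg _) hz (by positivity)
        gcongr
      have h2 : |z α| ≤ M := (by simpa using PiLp.norm_apply_le z α : |z α| ≤ ‖z‖).trans hz
      have h3 : |G i| ≤ c / ρ := (by simpa using PiLp.norm_apply_le G i : |G i| ≤ ‖G‖).trans hG
      gcongr
    calc |∑ α, ∑ i, a (α, i) * (z α * ((k * H) * G i))|
        ≤ ∑ α, ∑ i, |a (α, i) * (z α * ((k * H) * G i))| :=
          (Finset.abs_sum_le_sum_abs _ _).trans
            (Finset.sum_le_sum fun α _ => Finset.abs_sum_le_sum_abs _ _)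
      _ ≤ ∑ α : Fin N, ∑ i : Fin n, Λ * (f + M₁ + X ^ (p - 1)) * (M * (k * H * (c / ρ))) :=
          Finset.sum_le_sum fun α _ => Finset.sum_le_sum fun i _ => hterm α i
      _ = τ * H * (f + M₁ + X ^ (p - 1)) := by
          simp only [Finset.sum_const, Finset.card_univ, Fintype.card_fin, nsmul_eq_mul, hτ, hT]
          ring
  have hcross' : τ * H * (f + M₁ + X ^ (p - 1)) ≤
      F + M₄ + κ / 4 * (ζ * X ^ p) + E * ρ ^ (-p) := by
    have y1 := mul_le_rpow_add_rpow hp hf hτ0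
    have y2 := mul_le_rpow_add_rpow hp hM₁0 hτ0
    have y3 := mul_rpow_sub_one_le hp (mul_nonneg hw0 hX0) hτ0 (by positivity : 0 < κ / 4)
    rw [hwX, Real.mul_rpow hw0 hX0] at y3
    have z1 : τ * H * f ≤ τ * f := by
      have : τ * f * H ≤ τ * f * 1 := by gcongr
      linarith
    have z2 : τ * H * M₁ ≤ τ * M₁ := by
      have : τ * M₁ * H ≤ τ * M₁ * 1 := by gcongr
      linarith
    have z3 : τ * H * X ^ (p - 1) ≤ τ * (w ^ (p - 1) * X ^ (p - 1)) := by
      rw [mul_assoc]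
      gcongr
    have e1 : E * ρ ^ (-p) = (2 + (κ / 4) ^ (1 - p)) * τ ^ p := by rw [hE, hτp]; ring
    rw [e1]
    linarith
  -- the terms containing `b`
  have hlower : |∑ α, b α * (ζ * z α)| ≤ ζ * (L * (g + M₂ + X ^ q)) := by
    have hterm : ∀ α, |b α * (ζ * z α)| ≤ Λ * (g + M₂ + X ^ q) * (ζ * M) := by
      intro α
      rw [abs_mul, abs_mul, abs_of_nonneg hζ0]
      have h1 : |b α| ≤ Λ * (g + M₂ + X ^ q) := by
        refine (hb α).trans ?_
        have : ‖z‖ ^ (P - 1) ≤ M₂ := Real.rpow_le_rpow (norm_nonneg _) hz hP1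
        gcongr
      have h2 : |z α| ≤ M := (by simpa using PiLp.norm_apply_le z α : |z α| ≤ ‖z‖).trans hz
      gcongr
    calc |∑ α, b α * (ζ * z α)| ≤ ∑ α, |b α * (ζ * z α)| := Finset.abs_sum_le_sum_abs _ _
      _ ≤ ∑ α : Fin N, Λ * (g + M₂ + X ^ q) * (ζ * M) := Finset.sum_le_sum fun α _ => hterm α
      _ = ζ * (L * (g + M₂ + X ^ q)) := by
          simp only [Finset.sum_const, Finset.card_univ, Fintype.card_fin, nsmul_eq_mul, hL]
          ring
  have hlower' : ζ * (L * (g + M₂ + X ^ q)) ≤ L * g + L * M₂ + κ / 4 * (ζ * X ^ p) + C₃ := by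
    have y1 : ζ * (L * X ^ q) ≤ ζ * (κ / 4 * X ^ p + C₃) := by
      gcongr
      exact hyoung X hX0
    have y2 : ζ * (L * g) ≤ 1 * (L * g) := by gcongr
    have y3 : ζ * (L * M₂) ≤ 1 * (L * M₂) := by gcongr
    have y4 : ζ * C₃ ≤ 1 * C₃ := by gcongr
    linarith
  have hmain : ζ * (κ * X ^ p) - Λ * M₃ - Λ * F ≤ ζ * ∑ α, ∑ i, a (α, i) * Ξ (α, i) := by
    have h1 : κ * X ^ p - (Λ * M₃ + Λ * F) ≤ ∑ α, ∑ i, a (α, i) * Ξ (α, i) := by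
      have : ‖z‖ ^ P ≤ M₃ := Real.rpow_le_rpow (norm_nonneg _) hz (by linarith)
      have : Λ * ‖z‖ ^ P ≤ Λ * M₃ := by gcongr
      linarith
    have h2 := mul_le_mul_of_nonneg_left h1 hζ0
    have h3 : ζ * (Λ * M₃ + Λ * F) ≤ 1 * (Λ * M₃ + Λ * F) := by gcongr
    linarith
  have hsum : ∑ α, ∑ i, a (α, i) * (ζ * Ξ (α, i) + z α * ((k * H) * G i))
      = ζ * (∑ α, ∑ i, a (α, i) * Ξ (α, i)) + ∑ α, ∑ i, a (α, i) * (z α * ((k * H) * G i)) := by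
    simp only [mul_add, Finset.sum_add_distrib, Finset.mul_sum]
    congr 1
    exact Finset.sum_congr rfl fun α _ => Finset.sum_congr rfl fun i _ => by ring
  rw [hsum]
  have habs₁ := (abs_le.1 (hcross.trans hcross')).1
  have habs₂ := (abs_le.1 (hlower.trans hlower')).1
  have hρp : 0 ≤ ρ ^ (-p) := by positivity
  set K := Λ + 1 + M₄ + L * M₂ + L + C₃ + Λ * M₃ + E with hK
  have hfinal : F + M₄ + E * ρ ^ (-p) + L * g + L * M₂ + C₃ + Λ * M₃ + Λ * F ≤
      K * (1 + ρ ^ (-p) + F + g) := by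
    have hLM := mul_nonneg hL0 hM₂0
    have hΛM := mul_nonneg hΛ.le hM₃0
    have a1 : M₄ + L * M₂ + C₃ + Λ * M₃ ≤ K := by linarith
    have a2 : E * ρ ^ (-p) ≤ K * ρ ^ (-p) := by
      gcongr
      linarith
    have a3 : (1 + Λ) * F ≤ K * F := by
      gcongr
      linarith
    have a4 : L * g ≤ K * g := by
      gcongr
      linarith
    linarith
  linarith

/-! ### The Caccioppoli inequality -/

section Integrability

variable {n N : ℕ} {Ω : Set (Vec n)} {p Λ M : ℝ} {φ ψ : Vec n → ℝ}
  {a : Vec n → Vec N → Mat N n → Mat N n} {b : Vec n → Vec N → Mat N n → Vec N}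
  {u : Vec n → Vec N} {Du : Vec n → Mat N n}

theorem integrable_norm_rpow_ofReal {F : Type*} [NormedAddCommGroup F] {f : Vec n → F}
    (hp : 0 < p) (hf : MemLp f (ENNReal.ofReal p) (volume.restrict Ω)) :
    IntegrableOn (fun x => ‖f x‖ ^ p) Ω := by
  have := hf.integrable_norm_rpow (by simpa using hp) (by simp)
  rwa [ENNReal.toReal_ofReal hp.le] at this

/-- The principal part of the weak formulation converges absolutely. -/
theorem integrable_principal_part (hp : 1 < p) (hpn : p < n) (hΛ : 0 < Λ) (hΩ : volume Ω < ∞)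
    (hφ0 : ∀ᵐ x ∂volume.restrict Ω, 0 ≤ φ x)
    (hφ : IntegrableOn (fun x => ‖φ x‖ ^ (p / (p - 1))) Ω)
    (ha : IsCaratheodory Ω a) (hg : ControlledGrowth Ω p Λ φ ψ a b)
    (hu : AEStronglyMeasurable u (volume.restrict Ω)) (huM : ∀ᵐ x ∂volume.restrict Ω, ‖u x‖ ≤ M)
    (hDu : MemLp Du (ENNReal.ofReal p) (volume.restrict Ω)) {Dv : Vec n → Mat N n}
    (hDv : MemLp Dv (ENNReal.ofReal p) (volume.restrict Ω)) :
    IntegrableOn (fun x => ∑ α, ∑ i, a x (u x) (Du x) (α, i) * Dv x (α, i)) Ω := by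
  have hp0 : 0 < p := by linarith
  have hP := one_lt_sobolevConj hp hpn
  have : IsFiniteMeasure (volume.restrict Ω) := ⟨by simpa using hΩ⟩
  refine integrable_finsetSum _ fun α _ => integrable_finsetSum _ fun i _ => ?_
  have hconst : Integrable
      (fun _ : Vec n => (M ^ (sobolevConj n p * (p - 1) / p)) ^ (p / (p - 1)))
      (volume.restrict Ω) := integrable_const _
  have hDuX := integrable_norm_rpow_ofReal hp0 hDu
  have hDvX := integrable_norm_rpow_ofReal hp0 hDv
  have hbound := ((((hφ.add hconst).add hDuX).add (hDvX.const_mul 3)).const_mul Λ)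
  have hmeas : ∀ {f : Vec n → Mat N n}, AEStronglyMeasurable f (volume.restrict Ω) →
      AEStronglyMeasurable (fun x => f x (α, i)) (volume.restrict Ω) := fun hf =>
    (by fun_prop : Continuous fun Ξ : Mat N n => Ξ (α, i)).comp_aestronglyMeasurable hf
  refine hbound.mono' ((hmeas (ha.aestronglyMeasurable_comp hu hDu.1)).mul (hmeas hDv.1)) ?_
  filter_upwards [hφ0, hg, huM] with x hφx hgx hux
  set M₁ := M ^ (sobolevConj n p * (p - 1) / p) with hM₁
  have hM0 : 0 ≤ M := (norm_nonneg _).trans hux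
  have hM₁0 : 0 ≤ M₁ := by positivity
  have h1 : ‖u x‖ ^ (sobolevConj n p * (p - 1) / p) ≤ M₁ := by
    have : 0 ≤ p - 1 := by linarith
    exact Real.rpow_le_rpow (norm_nonneg _) hux (by positivity)
  have h2 : |Dv x (α, i)| ≤ ‖Dv x‖ := by simpa using PiLp.norm_apply_le (Dv x) (α, i)
  have y1 := mul_le_rpow_add_rpow hp hφx (norm_nonneg (Dv x))
  have y2 := mul_le_rpow_add_rpow hp hM₁0 (norm_nonneg (Dv x))
  have y3 := mul_rpow_sub_one_le hp (norm_nonneg (Du x)) (norm_nonneg (Dv x)) one_pos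
  rw [Real.one_rpow, one_mul, one_mul] at y3
  rw [norm_mul, Real.norm_eq_abs, Real.norm_eq_abs]
  simp only [Pi.add_apply]
  rw [Real.norm_of_nonneg hφx]
  calc |a x (u x) (Du x) (α, i)| * |Dv x (α, i)|
      ≤ Λ * (φ x + M₁ + ‖Du x‖ ^ (p - 1)) * ‖Dv x‖ := by
        refine mul_le_mul (((hgx (u x) (Du x)).1 α i).trans ?_) h2 (abs_nonneg _) (by positivity)
        gcongr
    _ = Λ * (‖Dv x‖ * φ x + ‖Dv x‖ * M₁ + ‖Dv x‖ * ‖Du x‖ ^ (p - 1)) := by ring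
    _ ≤ _ := mul_le_mul_of_nonneg_left (by linarith) hΛ.le

/-- The lower order part of the weak formulation converges absolutely for bounded test functions. -/
theorem integrable_lower_order_part (hp : 1 < p) (hpn : p < n) (hΛ : 0 < Λ) (hΩ : volume Ω < ∞)
    (hψ : IntegrableOn ψ Ω) (hψ0 : ∀ᵐ x ∂volume.restrict Ω, 0 ≤ ψ x)
    (hb : IsCaratheodory Ω b) (hg : ControlledGrowth Ω p Λ φ ψ a b)
    (hu : AEStronglyMeasurable u (volume.restrict Ω)) (huM : ∀ᵐ x ∂volume.restrict Ω, ‖u x‖ ≤ M)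
    (hDu : MemLp Du (ENNReal.ofReal p) (volume.restrict Ω)) {v : Vec n → Vec N}
    (hv : AEStronglyMeasurable v (volume.restrict Ω))
    (hvM : ∀ᵐ x ∂volume.restrict Ω, ‖v x‖ ≤ M) :
    IntegrableOn (fun x => ∑ α, b x (u x) (Du x) α * v x α) Ω := by
  have hp0 : 0 < p := by linarith
  have hP := one_lt_sobolevConj hp hpn
  have : IsFiniteMeasure (volume.restrict Ω) := ⟨by simpa using hΩ⟩
  obtain ⟨C, hC0, hC⟩ := exists_mul_rpow_le (gradient_exponent_nonneg hp hpn)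
    (gradient_exponent_lt hp hpn) zero_le_one one_pos
  refine integrable_finsetSum _ fun α _ => ?_
  have hconst : Integrable (fun _ : Vec n => M ^ (sobolevConj n p - 1) + C)
      (volume.restrict Ω) := integrable_const _
  have hDuX := integrable_norm_rpow_ofReal hp0 hDu
  have hbound := (((hψ.add hconst).add hDuX).const_mul (Λ * M))
  have hmeas : ∀ {f : Vec n → Vec N}, AEStronglyMeasurable f (volume.restrict Ω) →
      AEStronglyMeasurable (fun x => f x α) (volume.restrict Ω) := fun hf =>
    (by fun_prop : Continuous fun z : Vec N => z α).comp_aestronglyMeasurable hf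
  refine hbound.mono' ((hmeas (hb.aestronglyMeasurable_comp hu hDu.1)).mul (hmeas hv)) ?_
  filter_upwards [hψ0, hg, huM, hvM] with x hψx hgx hux hvx
  have hM0 : 0 ≤ M := (norm_nonneg _).trans hux
  have h1 : ‖u x‖ ^ (sobolevConj n p - 1) ≤ M ^ (sobolevConj n p - 1) :=
    Real.rpow_le_rpow (norm_nonneg _) hux (by linarith)
  have h2 : |v x α| ≤ M := (by simpa using PiLp.norm_apply_le (v x) α : |v x α| ≤ ‖v x‖).trans hvx
  have y := hC ‖Du x‖ (norm_nonneg _)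
  rw [one_mul, one_mul] at y
  rw [norm_mul, Real.norm_eq_abs, Real.norm_eq_abs]
  simp only [Pi.add_apply]
  calc |b x (u x) (Du x) α| * |v x α|
      ≤ Λ * (ψ x + (M ^ (sobolevConj n p - 1) + C) + ‖Du x‖ ^ p) * M := by
        refine mul_le_mul (((hgx (u x) (Du x)).2 α).trans ?_) h2 (abs_nonneg _) (by positivity)
        gcongr ?_ * ?_
        linarith
    _ = _ := by ring

end Integrability

/-- The weak formulation is tested with `η ^ k • u`, where `η` is a cutoff function. Since `u` has
zero boundary values, this is an admissible test function for every ball, whether or not the ball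
meets the boundary of `Ω`. -/
theorem exists_caccioppoli (n N : ℕ) {p κ Λ M : ℝ} (hp : 1 < p) (hpn : p < n) (hκ : 0 < κ)
    (hΛ : 0 < Λ) (hM : 0 ≤ M) :
    ∃ C : ℝ, 0 ≤ C ∧ ∀ (Ω : Set (Vec n)) (φ ψ : Vec n → ℝ)
      (a : Vec n → Vec N → Mat N n → Mat N n) (b : Vec n → Vec N → Mat N n → Vec N)
      (u : Vec n → Vec N) (Du : Vec n → Mat N n),
      volume Ω < ∞ →
      (∀ᵐ x ∂volume.restrict Ω, 0 ≤ φ x) → IntegrableOn (fun x => ‖φ x‖ ^ (p / (p - 1))) Ω →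
      (∀ᵐ x ∂volume.restrict Ω, 0 ≤ ψ x) → IntegrableOn ψ Ω →
      IsCaratheodory Ω a → IsCaratheodory Ω b →
      ControlledGrowth Ω p Λ φ ψ a b → Coercive Ω p κ Λ φ a →
      IsWeakSolution Ω p a b u Du → (∀ᵐ x ∂volume.restrict Ω, ‖u x‖ ≤ M) →
      ∀ (x₀ : Vec n) (ρ : ℝ), 0 < ρ →
        ∫ x in Metric.ball x₀ ρ ∩ Ω, ‖Du x‖ ^ p ≤
          C * ∫ x in Metric.ball x₀ (2 * ρ) ∩ Ω,
            (1 + ρ ^ (-p) + ‖φ x‖ ^ (p / (p - 1)) + ‖ψ x‖) := by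
  obtain ⟨c, hc0, hc⟩ := exists_cutoff n
  obtain ⟨C, hC0, hC⟩ := exists_pointwise_estimate n N hp hpn hκ hΛ hM hc0
  refine ⟨2 / κ * C, by positivity, ?_⟩
  intro Ω φ ψ a b u Du hΩ hφ0 hφ hψ0 hψ ha hb hg hcoer hsol huM x₀ ρ hρ
  have hp0 : 0 < p := by linarith
  have : IsFiniteMeasure (volume.restrict Ω) := ⟨by simpa using hΩ⟩
  obtain ⟨η, hη, hηc, hη0, hη1, hηone, hηzero, hηgrad⟩ := hc x₀ ρ hρ
  set k := ⌈p⌉₊ with hk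
  have hk2 : 2 ≤ k := Nat.lt_ceil.2 (by simpa using hp)
  have hζ : ContDiff ℝ (⊤ : ℕ∞) fun x => η x ^ k := hη.pow k
  have hζc : HasCompactSupport fun x => η x ^ k := by
    refine hηc.mono fun x hx => ?_
    contrapose! hx
    simp only [Function.mem_support, not_not] at hx ⊢
    rw [hx, zero_pow (by omega)]
  have hv := hsol.1.smooth_smul hp.le hΩ hζ hζc
  set v : Vec n → Vec N := fun x => η x ^ k • u x with hvdef
  set Dv : Vec n → Mat N n := fun x => WithLp.toLp 2 fun q =>
    η x ^ k * Du x q + u x q.1 * gradient (fun x => η x ^ k) x q.2 with hDvdef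
  have hu := hsol.1.memLp_fst
  have hDu := hsol.1.memLp_snd
  have hvM : ∀ᵐ x ∂volume.restrict Ω, ‖v x‖ ≤ M := by
    filter_upwards [huM] with x hx
    rw [hvdef, norm_smul, norm_pow, Real.norm_of_nonneg (hη0 x)]
    exact (mul_le_of_le_one_left (norm_nonneg _) (pow_le_one₀ (hη0 x) (hη1 x))).trans hx
  have hIa := integrable_principal_part hp hpn hΛ hΩ hφ0 hφ ha hg hu.1 huM hDu hv.memLp_snd
  have hIb := integrable_lower_order_part hp hpn hΛ hΩ hψ hψ0 hb hg hu.1 huM hDu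
    hv.memLp_fst.1 hvM
  have hzero := hsol.2 v Dv hv
  set Sa : Vec n → ℝ := fun x => ∑ α, ∑ i, a x (u x) (Du x) (α, i) * Dv x (α, i) with hSa
  set Sb : Vec n → ℝ := fun x => ∑ α, b x (u x) (Du x) α * v x α with hSb
  set Q : Vec n → ℝ := fun x => 1 + ρ ^ (-p) + ‖φ x‖ ^ (p / (p - 1)) + ‖ψ x‖ with hQ
  have hQint : IntegrableOn Q Ω := ((integrable_const _).add hφ).add hψ.norm
  have hDuX : IntegrableOn (fun x => ‖Du x‖ ^ p) Ω := integrable_norm_rpow_ofReal hp0 hDu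
  have hpoint : ∀ᵐ x ∂volume.restrict Ω,
      (Metric.ball x₀ ρ).indicator (fun x => κ / 2 * ‖Du x‖ ^ p) x ≤
        Sa x + Sb x + (Metric.ball x₀ (2 * ρ)).indicator (fun x => C * Q x) x := by
    filter_upwards [hφ0, hψ0, hg, hcoer, huM] with x hφx hψx hgx hcx hux
    have hDv : ∀ α i, Dv x (α, i) =
        η x ^ k * Du x (α, i) + u x α * ((k * η x ^ (k - 1)) * gradient η x i) := by
      intro α i
      simp only [hDvdef]
      rw [gradient_fun_pow (hη.differentiable (by simp) x)]
      rfl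
    by_cases hx2 : x ∈ Metric.ball x₀ (2 * ρ)
    · have key := hC ρ (u x) (Du x) (a x (u x) (Du x)) (b x (u x) (Du x)) (φ x) (ψ x) (η x)
        (gradient η x) hρ hux hφx hψx (hη0 x) (hη1 x) (hηgrad x) (hgx (u x) (Du x)).1
        (hgx (u x) (Du x)).2 (hcx (u x) (Du x))
      rw [Set.indicator_of_mem hx2]
      refine le_trans ?_ (key.trans (le_of_eq ?_))
      · by_cases hx1 : x ∈ Metric.ball x₀ ρ
        · rw [Set.indicator_of_mem hx1, hηone x hx1, one_pow, one_mul]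
        · rw [Set.indicator_of_notMem hx1]
          have := hη0 x
          positivity
      · simp only [hSa, hSb, hQ, hDv, Real.norm_of_nonneg hφx, Real.norm_of_nonneg hψx]
        rfl
    · have hx1 : x ∉ Metric.ball x₀ ρ := fun h =>
        hx2 (Metric.ball_subset_ball (by linarith) h)
      have e : η x = 0 := hηzero x hx2
      have e1 : Sa x = 0 := by
        simp only [hSa, hDv, e]
        simp [show k ≠ 0 by omega, show k - 1 ≠ 0 by omega]
      have e2 : Sb x = 0 := by
        simp only [hSb, hvdef, e]
        simp [show k ≠ 0 by omega]
      rw [Set.indicator_of_notMem hx1, Set.indicator_of_notMem hx2, e1, e2]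
      simp
  have hint := integral_mono_ae
    ((hDuX.const_mul (κ / 2)).indicator measurableSet_ball)
    ((hIa.add hIb).add ((hQint.const_mul C).indicator measurableSet_ball)) hpoint
  have hab : Integrable (fun x => Sa x + Sb x) (volume.restrict Ω) := hIa.add hIb
  simp only [Pi.add_apply] at hint
  rw [integral_add hab ((hQint.const_mul C).indicator measurableSet_ball),
    integral_add hIa hIb, hzero, zero_add, setIntegral_indicator measurableSet_ball,
    setIntegral_indicator measurableSet_ball, integral_const_mul, integral_const_mul,
    Set.inter_comm Ω, Set.inter_comm Ω] at hint
  calc ∫ x in Metric.ball x₀ ρ ∩ Ω, ‖Du x‖ ^ p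
      = 2 / κ * (κ / 2 * ∫ x in Metric.ball x₀ ρ ∩ Ω, ‖Du x‖ ^ p) := by field_simp
    _ ≤ 2 / κ * (C * ∫ x in Metric.ball x₀ (2 * ρ) ∩ Ω, Q x) := by gcongr
    _ = _ := by ring

/-! ### The Morrey estimate for the gradient -/

/-- Decay bounds for the integrals over balls give membership in a Morrey space. -/
theorem memMorrey_of_integral_ball_le {n : ℕ} {F : Type*} [NormedAddCommGroup F]
    {Ω : Set (Vec n)} {p d C : ℝ} (hp : 0 < p) {f : Vec n → F}
    (hf : MemLp f (ENNReal.ofReal p) (volume.restrict Ω))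
    (h : ∀ x₀ ∈ Ω, ∀ ρ ∈ Set.Ioo 0 (Metric.diam Ω),
      ∫ x in Metric.ball x₀ ρ ∩ Ω, ‖f x‖ ^ p ≤ C * ρ ^ d) :
    MemMorrey Ω p d f := by
  refine ⟨hf, ?_⟩
  refine lt_of_le_of_lt (b := ENNReal.ofReal C ^ (1 / p)) ?_
    (ENNReal.rpow_lt_top_of_nonneg (by positivity) (by finiteness))
  unfold morreyNorm
  refine iSup₂_le fun x₀ hx₀ => iSup₂_le fun ρ hρ => ?_
  have hρd : 0 < ρ ^ d := Real.rpow_pos_of_pos hρ.1 _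
  have hint : IntegrableOn (fun x => ‖f x‖ ^ p) (Metric.ball x₀ ρ ∩ Ω) :=
    (integrable_norm_rpow_ofReal hp hf).mono_set Set.inter_subset_right
  have e : ∫⁻ x in Metric.ball x₀ ρ ∩ Ω, ‖f x‖ₑ ^ p
      = ENNReal.ofReal (∫ x in Metric.ball x₀ ρ ∩ Ω, ‖f x‖ ^ p) := by
    rw [ofReal_integral_eq_lintegral_ofReal hint (ae_of_all _ fun x => by positivity)]
    refine lintegral_congr fun x => ?_
    rw [← ENNReal.ofReal_rpow_of_nonneg (norm_nonneg _) hp.le, ofReal_norm]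
  rw [e, ← ENNReal.ofReal_mul (by positivity)]
  gcongr
  rw [one_div_mul_eq_div, div_le_iff₀ hρd]
  exact h x₀ hx₀ ρ hρ

theorem theorem4p1 (n N : ℕ) (hN : 1 < N) (p : ℝ) (hp : 1 < p) (hpn : p < n)
    (κ Λ : ℝ) (hκ : 0 < κ) (hΛ : 0 < Λ) (A : ℝ) (hA : A ∈ Set.Ioo (0 : ℝ) 1)
    (r l s m : ℝ)
    (hr : p / (p - 1) < r) (hl : l ∈ Set.Ico (0 : ℝ) n) (hrl : n < (p - 1) * r + l)
    (hs : n * p / (n * p + p - n) < s) (hm : m ∈ Set.Ico (0 : ℝ) n) (hsm : n < p * s + m)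
    (V Kφ Kψ M : ℝ≥0) :
    ∃ C : ℝ, ∀ (Ω : Set (Vec n)) (φ ψ : Vec n → ℝ)
      (a : Vec n → Vec N → Mat N n → Mat N n) (b : Vec n → Vec N → Mat N n → Vec N)
      (u : Vec n → Vec N) (Du : Vec n → Mat N n),
      IsBoundedDomain Ω → volume Ω ≤ V → MeasureDensity Ω A →
      (∀ᵐ x ∂volume.restrict Ω, 0 ≤ φ x) → MemMorrey Ω r l φ → morreyNorm Ω r l φ ≤ Kφ →
      (∀ᵐ x ∂volume.restrict Ω, 0 ≤ ψ x) → MemMorrey Ω s m ψ → morreyNorm Ω s m ψ ≤ Kψ →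
      IsCaratheodory Ω a → IsCaratheodory Ω b →
      ControlledGrowth Ω p Λ φ ψ a b → Coercive Ω p κ Λ φ a →
      IsWeakSolution Ω p a b u Du → eLpNorm u ∞ (volume.restrict Ω) ≤ M →
      (∀ x₀ ∈ closure Ω, ∀ ρ ∈ Set.Ioo 0 (Metric.diam Ω),
        ∫ x in Metric.ball x₀ ρ ∩ Ω, ‖Du x‖ ^ p ≤ C * ρ ^ ((n : ℝ) - p)) ∧
      MemMorrey Ω p (n - p) Du := by
  have hn : 0 < n := by
    have : (0 : ℝ) < n := by linarith
    exact_mod_cast this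
  have : Nonempty (Fin n) := ⟨⟨0, hn⟩⟩
  have hp0 : 0 < p := by linarith
  have hp1 : 0 < p - 1 := by linarith
  have he : 0 < p / (p - 1) := by positivity
  have hs1 : 1 ≤ s := by
    refine le_trans ?_ hs.le
    rw [one_le_div (by nlinarith)]
    linarith
  have hr0 : 0 < r := he.trans hr
  -- the two Morrey conditions on `φ` and `ψ` are what makes both decay exponents at least `n - p`
  have hdφ : (n : ℝ) - p ≤ n - (n - l) * (p / (p - 1) / r) := by
    have : (n - l) * (p / (p - 1) / r) ≤ p := by
      rw [div_div, ← mul_div_assoc, div_le_iff₀ (by positivity)]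
      nlinarith
    linarith
  have hdψ : (n : ℝ) - p ≤ n - (n - m) * (1 / s) := by
    have : (n - m) * (1 / s) ≤ p := by
      rw [mul_one_div, div_le_iff₀ (by linarith)]
      linarith
    linarith
  obtain ⟨D, hD0, hD⟩ := exists_bound_radius hn hA.1 V
  obtain ⟨Cφ, -, hCφ⟩ := exists_integral_rpow_ball_closure_le hn he hr.le hl.1 hdφ Kφ D
  obtain ⟨Cψ, -, hCψ⟩ := exists_integral_rpow_ball_closure_le hn one_pos hs1 hm.1 hdψ Kψ D
  obtain ⟨C, hC0, hC⟩ := exists_caccioppoli n N hp hpn hκ hΛ M.2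
  set ω : ℝ := volume.real (Metric.ball (0 : Vec n) 1) with hω
  have hω0 : 0 ≤ ω := measureReal_nonneg
  refine ⟨C * (ω * 2 ^ n * (D ^ p + 1) + Cφ + Cψ), ?_⟩
  intro Ω φ ψ a b u Du hdom hV hden hφ0 hφm hφK hψ0 hψm hψK ha hb hg hcoer hsol huM
  have hΩ : volume Ω < ∞ := hV.trans_lt ENNReal.coe_lt_top
  have : IsFiniteMeasure (volume.restrict Ω) := ⟨by simpa using hΩ⟩
  have hφint : IntegrableOn (fun x => ‖φ x‖ ^ (p / (p - 1))) Ω :=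
    integrable_norm_rpow_ofReal he (hφm.1.mono_exponent (ENNReal.ofReal_le_ofReal hr.le))
  have hψint : IntegrableOn ψ Ω :=
    hψm.1.integrable (by simpa using ENNReal.ofReal_le_ofReal hs1)
  have hψint1 : IntegrableOn (fun x => ‖ψ x‖ ^ (1 : ℝ)) Ω := by
    simp only [Real.rpow_one]
    exact hψint.norm
  have huM' : ∀ᵐ x ∂volume.restrict Ω, ‖u x‖ ≤ M := by
    rw [eLpNorm_exponent_top] at huM
    filter_upwards [ae_le_eLpNormEssSup (f := u) (μ := volume.restrict Ω)] with x hx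
    exact enorm_le_coe.1 (hx.trans huM)
  have hmain : ∀ x₀ ∈ closure Ω, ∀ ρ ∈ Set.Ioo 0 (Metric.diam Ω),
      ∫ x in Metric.ball x₀ ρ ∩ Ω, ‖Du x‖ ^ p ≤
        C * (ω * 2 ^ n * (D ^ p + 1) + Cφ + Cψ) * ρ ^ ((n : ℝ) - p) := by
    intro x₀ hx₀ ρ hρ
    have hρ0 : 0 < ρ := hρ.1
    have hdiam : 0 < Metric.diam Ω := hρ.1.trans hρ.2
    have hρD : ρ ≤ D := hD Ω hdom.2.1.nonempty hV hden ρ hρ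
    have key := hC Ω φ ψ a b u Du hΩ hφ0 hφint hψ0 hψint ha hb hg hcoer hsol huM' x₀ ρ hρ0
    have kφ := hCφ Ω φ hdom.2.2 hdiam hφm.1.1 hφK hφint x₀ hx₀ ρ hρ0 hρD
    have kψ := hCψ Ω ψ hdom.2.2 hdiam hψm.1.1 hψK hψint1 x₀ hx₀ ρ hρ0 hρD
    simp only [Real.rpow_one] at kψ
    set B := Metric.ball x₀ (2 * ρ) ∩ Ω with hB
    have hBΩ : B ⊆ Ω := Set.inter_subset_right
    have hvol : volume.real B ≤ ω * 2 ^ n * ρ ^ (n : ℝ) := by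
      refine (measureReal_mono Set.inter_subset_left (by finiteness)).trans (le_of_eq ?_)
      rw [Measure.real, Measure.addHaar_ball _ _ (by positivity), ENNReal.toReal_mul,
        ENNReal.toReal_ofReal (by positivity), hω, Measure.real, finrank_euclideanSpace_fin,
        Real.rpow_natCast]
      ring
    have hρn : ρ ^ (n : ℝ) = ρ ^ p * ρ ^ ((n : ℝ) - p) := by
      rw [← Real.rpow_add hρ0]
      congr 1
      ring
    have hconst : ∫ _ in B, (1 + ρ ^ (-p)) ≤ ω * 2 ^ n * (D ^ p + 1) * ρ ^ ((n : ℝ) - p) := by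
      rw [setIntegral_const, smul_eq_mul]
      calc volume.real B * (1 + ρ ^ (-p)) ≤ ω * 2 ^ n * ρ ^ (n : ℝ) * (1 + ρ ^ (-p)) := by gcongr
        _ = ω * 2 ^ n * (ρ ^ p + 1) * ρ ^ ((n : ℝ) - p) := by
            have : ρ ^ p * ρ ^ (-p) = 1 := by rw [← Real.rpow_add hρ0, add_neg_cancel, Real.rpow_zero]
            rw [hρn]
            linear_combination ω * 2 ^ n * ρ ^ ((n : ℝ) - p) * this
        _ ≤ _ := by gcongr
    have hsum : ∫ x in B, (1 + ρ ^ (-p) + ‖φ x‖ ^ (p / (p - 1)) + ‖ψ x‖)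
        = (∫ _ in B, (1 + ρ ^ (-p))) + (∫ x in B, ‖φ x‖ ^ (p / (p - 1))) + ∫ x in B, ‖ψ x‖ := by
      have : IsFiniteMeasure (volume.restrict B) :=
        ⟨by simpa using (measure_mono hBΩ).trans_lt hΩ⟩
      have i1 : Integrable (fun _ : Vec n => 1 + ρ ^ (-p)) (volume.restrict B) :=
        integrable_const _
      have i2 := hφint.mono_set hBΩ
      have i12 : Integrable (fun x => 1 + ρ ^ (-p) + ‖φ x‖ ^ (p / (p - 1)))
        (volume.restrict B) := i1.add i2
      rw [integral_add i12 (hψint.mono_set hBΩ).norm, integral_add i1 i2]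
    rw [hsum] at key
    refine key.trans ?_
    rw [mul_assoc]
    gcongr
    linarith
  exact ⟨hmain, memMorrey_of_integral_ball_le hp0 hsol.1.memLp_snd fun x₀ hx₀ =>
    hmain x₀ (subset_closure hx₀)⟩
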